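/- Let $-1<\rho<1$, $\theta\in\mathbb R$, $R=\begin{pmatrix}1&\rho\\ \rho&1\end{pmatrix}$, and let $\mathbf X=(X_1,X_2)^T\sim SN_2(\boldsymbol\theta,R)$ with $\boldsymbol\theta=(\theta,\theta)^T$; that is, $\mathbf X$ has the density $f(\mathbf x)=2\,\phi_2(\mathbf x,R)\,\Phi(\boldsymbol\theta^T\mathbf x)$ on $\mathbb R^2$, where $\phi_2(\cdot,R)$ is the density of the bivariate normal distribution with mean $\mathbf 0$ and correlation matrix $R$, and $\Phi$ is the standard normal cdf. Let $F_i$ be the cdf of $X_i$, let $F_i^{-1}(u)=\inf\{x: F_i(x)\ge u\}$, and let $$\lambda_U(u)=P\bigl(X_1\ge F_1^{-1}(u)\,\big|\,X_2\ge F_2^{-1}(u)\bigr),\qquad 0<u<1,$$ be the upper tail dependence function. Here $f\sim g$ means $f/g\to1$. Then, as $u\to1^-$: (a) if $\theta<0$, $$\lambda_U(u)\sim(1-u)^{\beta^2}\,\frac{\alpha^3}{\pi\lambda^4\beta(1+\beta^2)^2}\sqrt{\frac2\pi}\,(2\pi\lambda)^{1+\beta^2}\Bigl(\frac{1+\lambda^2}{2}\Bigr)^{3/2}\bigl[-\log(1-u)\bigr]^{\beta^2-\frac12},$$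 where $\lambda=\frac{|\theta|(1+\rho)}{\sqrt{1+\theta^2(1-\rho^2)}}$, $\alpha=\frac{|\theta|(1+\rho)}{\sqrt{1+2\theta^2(1+\rho)}}$ and $\beta=\sqrt{\frac{(1-\rho)(1+2\theta^2(1+\rho))}{1+\rho}}$; (b) if $\theta>0$, $$\lambda_U(u)\sim(1-u)^{\frac{1-\rho}{1+\rho}}\cdot\frac{1+\rho}{2}\sqrt{\frac{1+\rho}{1-\rho}}\,\bigl(-\pi\log(1-u)\bigr)^{-\frac{\rho}{1+\rho}}.$$ -/

import Mathlib

open MeasureTheory ProbabilityTheory Filter Topology Asymptotics Matrix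

noncomputable section

namespace SkewNormal

/-- The cdf `Φ` of the univariate standard normal distribution. -/
def stdNormalCDF (x : ℝ) : ℝ := cdf (gaussianReal 0 1) x

/-- The correlation matrix with off-diagonal entry `ρ`. -/
def corrMatrix (ρ : ℝ) : Matrix (Fin 2) (Fin 2) ℝ := !![1, ρ; ρ, 1]

/-- The density `φ₂(x, R)` of the bivariate normal distribution with mean `0` and positive
definite covariance matrix `R`. -/
def bivNormalPDF (R : Matrix (Fin 2) (Fin 2) ℝ) (x : Fin 2 → ℝ) : ℝ :=
  1 / (2 * Real.pi * √R.det) * Real.exp (-(1 / 2) * (x ⬝ᵥ (R⁻¹ *ᵥ x)))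

/-- The density `2 φ₂(x, R) Φ(θᵀ x)` of the bivariate skew normal distribution. -/
def skewNormalPDF (θ : Fin 2 → ℝ) (R : Matrix (Fin 2) (Fin 2) ℝ) (x : Fin 2 → ℝ) : ℝ :=
  2 * bivNormalPDF R x * stdNormalCDF (θ ⬝ᵥ x)

/-- The bivariate skew normal distribution `SN₂(θ, R)`: the measure on `ℝ²` with density
`skewNormalPDF θ R` with respect to Lebesgue measure. -/
def skewNormal (θ : Fin 2 → ℝ) (R : Matrix (Fin 2) (Fin 2) ℝ) : Measure (Fin 2 → ℝ) :=
  volume.withDensity fun x => ENNReal.ofReal (skewNormalPDF θ R x)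

/-- The inverse distribution function `F⁻¹(u) = inf {x | u ≤ F(x)}` of a distribution on `ℝ`. -/
def quantile (μ : Measure ℝ) (u : ℝ) : ℝ := sInf {x : ℝ | u ≤ cdf μ x}

/-- The upper tail dependence function
`λ_U(u) = P(X₁ ≥ F₁⁻¹(u) | X₂ ≥ F₂⁻¹(u))`, where `Fᵢ` is the cdf of the `i`-th marginal
(the coordinates are indexed by `0` and `1`). -/
def upperTailDep {Ω : Type*} [MeasurableSpace Ω] (P : Measure Ω) (X : Ω → Fin 2 → ℝ)
    (u : ℝ) : ℝ :=
  (cond P {ω | quantile (P.map fun ω => X ω 1) u ≤ X ω 1}).real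
    {ω | quantile (P.map fun ω => X ω 0) u ≤ X ω 0}

end SkewNormal

end

/-!
Both the marginal tails and the joint tail of the skew normal law are integrals of
`exp (-Q x) * Φ (L x)`, for a quadratic form `Q` and a linear form `L`, over a cone translated
by `t • e`, so one application of Laplace's method treats them all. The substitution
`x = t • e + t⁻¹ • a` fixes the cone and splits `Q x` into `t² Q e`, the linear term `polar Q e a`
and a vanishing remainder. If `0 < L e`, the factor `Φ (L x)` tends to `1`. If `L e < 0`, the Mills
ratio turns it into `exp (-(L x)² / 2)`, up to a power of `t`, and the new exponent joins `Q`.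

Hence the marginal tail is `c t⁻ᵏ exp (-K t²)` and the joint tail is `d t⁻ᵐ exp (-K (1 + b) t²)`,
asymptotically. At `t = F⁻¹(u)` the marginal tail is `1 - u`, so `t² ~ -log (1 - u) / K`, and
eliminating `t` from the quotient of the two tails leaves `(1 - u) ^ b` times a power of the
logarithm.
-/

noncomputable section

namespace SkewNormal

section Laplace

variable {E : Type*} [NormedAddCommGroup E] [NormedSpace ℝ E]

theorem quadraticForm_smul_add_inv_smul (Q : QuadraticForm ℝ E) (e a : E) {t : ℝ} (ht : t ≠ 0) :
    Q (t • e + t⁻¹ • a) = Q e * t ^ 2 + QuadraticMap.polar Q e a + Q a / t ^ 2 := by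
  rw [QuadraticMap.map_add Q, Q.map_smul, Q.map_smul, QuadraticMap.polar_smul_left,
    QuadraticMap.polar_smul_right]
  simp only [smul_eq_mul]
  field_simp
  ring

variable [FiniteDimensional ℝ E]

theorem continuous_quadraticForm (Q : QuadraticForm ℝ E) : Continuous Q := by
  have h : ∀ x, Q x = 2⁻¹ * Q.polarBilin.toContinuousBilinearMap x x := fun x => by
    simp [QuadraticMap.polar_self]
  simp only [funext h]
  fun_prop

variable [MeasurableSpace E] [BorelSpace E] {μ : Measure E} [μ.IsAddHaarMeasure] {s : Set E}

open scoped Pointwise in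
theorem setIntegral_comp_affine_of_cone (hs : ∀ r : ℝ, 0 < r → ∀ a ∈ s, r • a ∈ s) (f : E → ℝ)
    (c : E) {t : ℝ} (ht : 0 < t) :
    ∫ a in s, f (c + t⁻¹ • a) ∂μ
      = t ^ Module.finrank ℝ E * ∫ x in {x | x - c ∈ s}, f x ∂μ := by
  have hsmul : t⁻¹ • s = s :=
    Set.Subset.antisymm (Set.smul_set_subset_iff.2 fun a => hs _ (inv_pos.2 ht) a)
      fun a ha => ⟨t • a, hs t ht a ha, inv_smul_smul₀ ht.ne' a⟩
  have htranslate := (measurePreserving_sub_right μ c).setIntegral_preimage_emb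
    (measurableEmbedding_subRight c) (fun a => f (c + a)) s
  simp only [add_sub_cancel] at htranslate
  rw [Measure.setIntegral_comp_smul_of_pos μ (fun a => f (c + a)) s (inv_pos.2 ht), hsmul,
    ← htranslate, inv_pow, inv_inv, smul_eq_mul]
  rfl

variable {Q : QuadraticForm ℝ E} {e : E} {g : E → ℝ} {p : ℕ} {B C : ℝ}

/-- The substitution `x = t e + t⁻¹ a` turns `Q x` into `t² Q e + polar Q e a + t⁻² Q a`, whose
last summand disappears in the limit. -/
theorem tendsto_setIntegral_exp_neg_mul (hs : MeasurableSet s)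
    (hcone : ∀ r : ℝ, 0 < r → ∀ a ∈ s, r • a ∈ s) (hQ : ∀ a ∈ s, 0 ≤ Q a) (hg : Measurable g)
    (hbound : ∀ t : ℝ, 0 < t → ∀ a ∈ s, |t ^ p * g (t • e + a)| ≤ B)
    (hlim : ∀ a ∈ s, Tendsto (fun t : ℝ => t ^ p * g (t • e + t⁻¹ • a)) atTop (𝓝 C))
    (hint : IntegrableOn (fun a => Real.exp (-QuadraticMap.polar Q e a)) s μ) :
    Tendsto (fun t : ℝ => t ^ (Module.finrank ℝ E + p) * Real.exp (Q e * t ^ 2) *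
        ∫ x in {x | x - t • e ∈ s}, Real.exp (-Q x) * g x ∂μ) atTop
      (𝓝 (C * ∫ a in s, Real.exp (-QuadraticMap.polar Q e a) ∂μ)) := by
  have hQm : Measurable Q := (continuous_quadraticForm Q).measurable
  have hdom : Tendsto (fun t : ℝ => ∫ a in s, t ^ p * g (t • e + t⁻¹ • a)
      * Real.exp (-QuadraticMap.polar Q e a - Q a / t ^ 2) ∂μ) atTop
      (𝓝 (∫ a in s, C * Real.exp (-QuadraticMap.polar Q e a) ∂μ)) := by
    refine tendsto_integral_filter_of_dominated_convergence
      (fun a => B * Real.exp (-QuadraticMap.polar Q e a)) ?_ ?_ (hint.const_mul B) ?_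
    · refine Eventually.of_forall fun t => Measurable.aestronglyMeasurable ?_
      simp only [QuadraticMap.polar]
      fun_prop
    · filter_upwards [eventually_gt_atTop 0] with t ht
      refine ae_restrict_of_forall_mem hs fun a ha => ?_
      rw [norm_mul, Real.norm_eq_abs, Real.norm_eq_abs, Real.abs_exp]
      have hle := hbound t ht _ (hcone _ (inv_pos.2 ht) a ha)
      have hB : 0 ≤ B := (abs_nonneg _).trans hle
      gcongr
      exact sub_le_self _ (div_nonneg (hQ a ha) (sq_nonneg t))
    · refine ae_restrict_of_forall_mem hs fun a ha => (hlim a ha).mul ?_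
      have h : Tendsto (fun t : ℝ => Q a / t ^ 2) atTop (𝓝 0) :=
        tendsto_const_nhds.div_atTop (tendsto_pow_atTop two_ne_zero)
      simpa using (h.const_sub (-QuadraticMap.polar Q e a)).rexp
  rw [integral_const_mul] at hdom
  refine hdom.congr' ?_
  filter_upwards [eventually_gt_atTop 0] with t ht
  have hexp : ∀ a, Real.exp (-QuadraticMap.polar Q e a - Q a / t ^ 2)
      = Real.exp (Q e * t ^ 2) * Real.exp (-Q (t • e + t⁻¹ • a)) := fun a => by
    rw [quadraticForm_smul_add_inv_smul Q e a ht.ne', ← Real.exp_add]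
    ring_nf
  simp only [hexp, mul_assoc, mul_left_comm _ (Real.exp (Q e * t ^ 2)), integral_const_mul]
  simp only [mul_comm (g _)]
  rw [setIntegral_comp_affine_of_cone hcone (fun x => Real.exp (-Q x) * g x) _ ht, pow_add]
  ring

theorem isEquivalent_setIntegral_exp_neg_mul (hs : MeasurableSet s)
    (hcone : ∀ r : ℝ, 0 < r → ∀ a ∈ s, r • a ∈ s) (hQ : ∀ a ∈ s, 0 ≤ Q a) (hg : Measurable g)
    (hbound : ∀ t : ℝ, 0 < t → ∀ a ∈ s, |t ^ p * g (t • e + a)| ≤ B)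
    (hlim : ∀ a ∈ s, Tendsto (fun t : ℝ => t ^ p * g (t • e + t⁻¹ • a)) atTop (𝓝 C)) (hC : C ≠ 0)
    (hint : ∫ a in s, Real.exp (-QuadraticMap.polar Q e a) ∂μ ≠ 0) :
    (fun t : ℝ => ∫ x in {x | x - t • e ∈ s}, Real.exp (-Q x) * g x ∂μ) ~[atTop]
      fun t => C * (∫ a in s, Real.exp (-QuadraticMap.polar Q e a) ∂μ)
        / t ^ (Module.finrank ℝ E + p) * Real.exp (-Q e * t ^ 2) := by
  have h := (isEquivalent_const_iff_tendsto (mul_ne_zero hC hint)).2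
    (tendsto_setIntegral_exp_neg_mul hs hcone hQ hg hbound hlim
      (Integrable.of_integral_ne_zero hint))
  refine (h.mul (IsEquivalent.refl (u := fun t : ℝ =>
      (t ^ (Module.finrank ℝ E + p))⁻¹ * Real.exp (-Q e * t ^ 2)))).congr_left ?_ |>.congr_right
    (.of_forall fun t => ?_)
  · filter_upwards [eventually_gt_atTop 0] with t ht
    rw [Pi.mul_apply, neg_mul, Real.exp_neg]
    field_simp
  · simp only [Pi.mul_apply, Function.const_apply]
    ring

end Laplace

theorem stdNormalCDF_neg (z : ℝ) :
    stdNormalCDF (-z) = ∫ x in Set.Ioi z, gaussianPDFReal 0 1 x := by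
  rw [stdNormalCDF, cdf_eq_real, measureReal_def, gaussianReal_apply_eq_integral _ one_ne_zero,
    ENNReal.toReal_ofReal (integral_nonneg fun x => gaussianPDFReal_nonneg _ _ _),
    ← integral_comp_neg_Ioi]
  simp [gaussianPDFReal]

theorem stdNormalCDF_pos (x : ℝ) : 0 < stdNormalCDF x := by
  have hsupport : Function.support (gaussianPDFReal 0 1) = Set.univ :=
    Set.eq_univ_of_forall fun x => (gaussianPDFReal_pos 0 1 x one_ne_zero).ne'
  rw [← neg_neg x, stdNormalCDF_neg, setIntegral_pos_iff_support_of_nonneg_ae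
    (.of_forall fun x => gaussianPDFReal_nonneg _ _ _)
    (integrable_gaussianPDFReal _ _).integrableOn, hsupport]
  simp

theorem measurable_stdNormalCDF : Measurable stdNormalCDF := (monotone_cdf _).measurable

theorem tendsto_stdNormalCDF_atTop : Tendsto stdNormalCDF atTop (𝓝 1) := tendsto_cdf_atTop _

theorem gaussianPDFReal_zero_one (x : ℝ) :
    gaussianPDFReal 0 1 x = (√(2 * Real.pi))⁻¹ * Real.exp (-(1 / 2) * x ^ 2) := by
  simp only [gaussianPDFReal, NNReal.coe_one, mul_one, sub_zero]
  ring_nf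

/-- The Mills ratio `(1 - Φ(z)) / φ(z)` of the standard normal distribution, which factors the
Gaussian decay out of the tails of `Φ`. -/
def millsRatio (z : ℝ) : ℝ := stdNormalCDF (-z) / gaussianPDFReal 0 1 z

theorem stdNormalCDF_eq_exp_mul_millsRatio (x : ℝ) :
    stdNormalCDF x
      = Real.exp (-(1 / 2) * x ^ 2) * ((√(2 * Real.pi))⁻¹ * millsRatio (-x)) := by
  have h := (gaussianPDFReal_pos 0 1 (-x) one_ne_zero).ne'
  rw [mul_left_comm, ← mul_assoc, ← neg_sq x, ← gaussianPDFReal_zero_one, millsRatio, neg_neg,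
    mul_div_cancel₀ _ h]

theorem millsRatio_nonneg (z : ℝ) : 0 ≤ millsRatio z :=
  div_nonneg (stdNormalCDF_pos _).le (gaussianPDFReal_nonneg _ _ _)

theorem measurable_millsRatio : Measurable millsRatio :=
  (measurable_stdNormalCDF.comp measurable_neg).div (measurable_gaussianPDFReal 0 1)

theorem mul_millsRatio_le_one {z : ℝ} (hz : 0 < z) : z * millsRatio z ≤ 1 := by
  have hcone : ∀ r : ℝ, 0 < r → ∀ a ∈ Set.Ioi (0 : ℝ), r • a ∈ Set.Ioi 0 :=
    fun r hr a ha => mul_pos hr ha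
  have hsubst := setIntegral_comp_affine_of_cone (μ := volume) hcone (gaussianPDFReal 0 1) z hz
  have htail : {x | x - z ∈ Set.Ioi 0} = Set.Ioi z := by ext; simp
  have hle : ∀ a, gaussianPDFReal 0 1 (z + z⁻¹ • a)
      ≤ gaussianPDFReal 0 1 z * Real.exp (-1 * a) := fun a => by
    rw [gaussianPDFReal_zero_one, gaussianPDFReal_zero_one, mul_assoc, ← Real.exp_add]
    gcongr
    have hsq : (z + z⁻¹ • a) ^ 2 = z ^ 2 + 2 * a + (z⁻¹ * a) ^ 2 := by
      rw [smul_eq_mul]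
      field_simp
      ring
    linarith [sq_nonneg (z⁻¹ * a)]
  rw [htail, ← stdNormalCDF_neg, Module.finrank_self, pow_one] at hsubst
  rw [millsRatio, mul_div_assoc', div_le_one (gaussianPDFReal_pos 0 1 z one_ne_zero), ← hsubst]
  refine (integral_mono_of_nonneg (.of_forall fun x => gaussianPDFReal_nonneg _ _ _)
    ((integrableOn_exp_mul_Ioi (by norm_num) 0).const_mul _) (.of_forall hle)).trans_eq ?_
  rw [integral_const_mul, integral_exp_mul_Ioi (by norm_num)]
  simp

/-- The quadratic form `x ↦ x² / 2` in the exponent of the standard normal density. -/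
def halfSq : QuadraticForm ℝ ℝ := (1 / 2 : ℝ) • QuadraticMap.sq

theorem halfSq_apply (x : ℝ) : halfSq x = 1 / 2 * x ^ 2 :=
  congrArg (1 / 2 * ·) (sq x).symm

theorem polar_halfSq (x y : ℝ) : QuadraticMap.polar halfSq x y = x * y := by
  rw [QuadraticMap.polar, halfSq_apply, halfSq_apply, halfSq_apply]
  ring

theorem halfSq_nonneg (x : ℝ) : 0 ≤ halfSq x := by
  rw [halfSq_apply]
  positivity

theorem integral_Ioi_exp_neg_mul {c : ℝ} (hc : 0 < c) :
    ∫ x in Set.Ioi 0, Real.exp (-(c * x)) = c⁻¹ := by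
  simp only [← neg_mul]
  rw [integral_exp_mul_Ioi (neg_neg_iff_pos.2 hc)]
  simp

theorem setOf_sub_smul_one_mem_Ioi (t : ℝ) : {x : ℝ | x - t • 1 ∈ Set.Ioi 0} = Set.Ioi t := by
  ext
  simp

theorem stdNormalCDF_neg_isEquivalent :
    (fun z => stdNormalCDF (-z)) ~[atTop] fun z => gaussianPDFReal 0 1 z / z := by
  have hint : ∫ a in Set.Ioi 0, Real.exp (-QuadraticMap.polar halfSq 1 a) = 1 := by
    simpa only [polar_halfSq, inv_one] using integral_Ioi_exp_neg_mul one_pos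
  have h := isEquivalent_setIntegral_exp_neg_mul (μ := volume) (e := (1 : ℝ)) (p := 0)
    (g := fun _ => (√(2 * Real.pi))⁻¹) (C := (√(2 * Real.pi))⁻¹) measurableSet_Ioi
    (fun r hr a ha => mul_pos hr ha) (fun a _ => halfSq_nonneg a) measurable_const
    (fun t _ a _ => by rw [pow_zero, one_mul]) (fun a _ => by simp) (by positivity)
    (hint.trans_ne one_ne_zero)
  refine (h.congr_left (.of_forall fun t => ?_)).congr_right (.of_forall fun t => ?_)
  · simp only [setOf_sub_smul_one_mem_Ioi, stdNormalCDF_neg, gaussianPDFReal_zero_one, halfSq_apply,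
      neg_mul, mul_comm (√(2 * Real.pi))⁻¹]
  · simp only [hint, halfSq_apply, gaussianPDFReal_zero_one, Module.finrank_self, add_zero, pow_one,
      one_pow, mul_one, div_mul_eq_mul_div]

theorem tendsto_mul_millsRatio : Tendsto (fun z => z * millsRatio z) atTop (𝓝 1) := by
  refine ((isEquivalent_iff_tendsto_one ?_).1 stdNormalCDF_neg_isEquivalent).congr fun z => ?_
  · filter_upwards [eventually_gt_atTop 0] with z hz
    exact (div_pos (gaussianPDFReal_pos 0 1 z one_ne_zero) hz).ne'
  · rw [Pi.div_apply, millsRatio]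
    field_simp

section RecedingCone

variable {E : Type*} [NormedAddCommGroup E] [NormedSpace ℝ E] {s : Set E} {L : Module.Dual ℝ E}
  {e : E}

theorem tendsto_dual_smul_add_inv_smul_div (L : Module.Dual ℝ E) (e a : E) :
    Tendsto (fun t : ℝ => L (t • e + t⁻¹ • a) / t) atTop (𝓝 (L e)) := by
  have h : Tendsto (fun t : ℝ => L e + L a / t ^ 2) atTop (𝓝 (L e + 0)) :=
    tendsto_const_nhds.add (tendsto_const_nhds.div_atTop (tendsto_pow_atTop two_ne_zero))
  rw [add_zero] at h
  refine h.congr' ?_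
  filter_upwards [eventually_gt_atTop 0] with t ht
  simp only [map_add, map_smul, smul_eq_mul]
  field_simp

theorem tendsto_dual_smul_add_inv_smul_atTop (hL : 0 < L e) (a : E) :
    Tendsto (fun t : ℝ => L (t • e + t⁻¹ • a)) atTop atTop := by
  refine ((tendsto_dual_smul_add_inv_smul_div L e a).pos_mul_atTop hL tendsto_id).congr' ?_
  filter_upwards [eventually_gt_atTop 0] with t ht
  exact div_mul_cancel₀ _ ht.ne'

theorem tendsto_mul_millsRatio_neg_dual (hL : L e < 0) (a : E) :
    Tendsto (fun t : ℝ => t * millsRatio (-L (t • e + t⁻¹ • a))) atTop (𝓝 (-L e)⁻¹) := by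
  have hL' : 0 < (-L) e := neg_pos.2 hL
  have h := (tendsto_mul_millsRatio.comp (tendsto_dual_smul_add_inv_smul_atTop hL' a)).mul
    ((tendsto_dual_smul_add_inv_smul_div (-L) e a).inv₀ hL'.ne')
  rw [one_mul] at h
  refine h.congr' ?_
  filter_upwards [(tendsto_dual_smul_add_inv_smul_atTop hL' a).eventually_gt_atTop 0] with t ht
  simp only [Function.comp_apply, LinearMap.neg_apply, inv_div] at ht ⊢
  rw [mul_right_comm, mul_div_cancel₀ _ ht.ne', mul_comm]

theorem abs_mul_millsRatio_neg_dual_le (hL : L e < 0) (hLs : ∀ a ∈ s, L a ≤ 0) {t : ℝ}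
    (ht : 0 < t) {a : E} (ha : a ∈ s) : |t * millsRatio (-L (t • e + a))| ≤ (-L e)⁻¹ := by
  have hle : t * -L e ≤ -L (t • e + a) := by
    rw [map_add, map_smul, smul_eq_mul]
    linarith [hLs a ha]
  have hpos : 0 < t * -L e := mul_pos ht (neg_pos.2 hL)
  rw [abs_of_nonneg (mul_nonneg ht.le (millsRatio_nonneg _)), ← one_div,
    le_div_iff₀ (neg_pos.2 hL), mul_right_comm]
  exact (mul_le_mul_of_nonneg_right hle (millsRatio_nonneg _)).trans
    (mul_millsRatio_le_one (hpos.trans_le hle))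

variable [FiniteDimensional ℝ E] [MeasurableSpace E] [BorelSpace E] {μ : Measure E}
  [μ.IsAddHaarMeasure] {Q : QuadraticForm ℝ E}

theorem isEquivalent_setIntegral_exp_neg_mul_stdNormalCDF_of_pos (hs : MeasurableSet s)
    (hcone : ∀ r : ℝ, 0 < r → ∀ a ∈ s, r • a ∈ s) (hQ : ∀ a ∈ s, 0 ≤ Q a) (hL : 0 < L e)
    (hint : ∫ a in s, Real.exp (-QuadraticMap.polar Q e a) ∂μ ≠ 0) :
    (fun t : ℝ => ∫ x in {x | x - t • e ∈ s}, Real.exp (-Q x) * stdNormalCDF (L x) ∂μ) ~[atTop]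
      fun t => (∫ a in s, Real.exp (-QuadraticMap.polar Q e a) ∂μ)
        / t ^ Module.finrank ℝ E * Real.exp (-Q e * t ^ 2) := by
  have h := isEquivalent_setIntegral_exp_neg_mul (g := fun x => stdNormalCDF (L x)) (p := 0)
    (B := 1) (C := 1) hs hcone hQ
    (measurable_stdNormalCDF.comp L.continuous_of_finiteDimensional.measurable)
    (fun t _ a _ => ?_) (fun a _ => ?_) one_ne_zero hint
  · simpa only [one_mul, add_zero] using h
  · rw [pow_zero, one_mul, abs_of_pos (stdNormalCDF_pos _)]
    exact cdf_le_one _ _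
  · simpa only [pow_zero, one_mul, Function.comp_def] using
      tendsto_stdNormalCDF_atTop.comp (tendsto_dual_smul_add_inv_smul_atTop hL a)

/-- Up to a Mills ratio, `Φ (L x)` is `exp (-(L x)² / 2)`, which is absorbed into `Q`. -/
theorem isEquivalent_setIntegral_exp_neg_mul_stdNormalCDF_of_neg (hs : MeasurableSet s)
    (hcone : ∀ r : ℝ, 0 < r → ∀ a ∈ s, r • a ∈ s) (hQ : ∀ a ∈ s, 0 ≤ Q a) (hL : L e < 0)
    (hLs : ∀ a ∈ s, L a ≤ 0)
    (hint : ∫ a in s, Real.exp (-(QuadraticMap.polar Q e a + L e * L a)) ∂μ ≠ 0) :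
    (fun t : ℝ => ∫ x in {x | x - t • e ∈ s}, Real.exp (-Q x) * stdNormalCDF (L x) ∂μ) ~[atTop]
      fun t => (√(2 * Real.pi))⁻¹ * (-L e)⁻¹
        * (∫ a in s, Real.exp (-(QuadraticMap.polar Q e a + L e * L a)) ∂μ)
        / t ^ (Module.finrank ℝ E + 1) * Real.exp (-(Q e + 1 / 2 * L e ^ 2) * t ^ 2) := by
  let Q' : QuadraticForm ℝ E := Q + (1 / 2 : ℝ) • QuadraticMap.linMulLin L L
  have hQ' : ∀ x, Q' x = Q x + 1 / 2 * L x ^ 2 := fun x => by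
    rw [sq]
    rfl
  have hpolar : ∀ a, QuadraticMap.polar Q' e a = QuadraticMap.polar Q e a + L e * L a := fun a => by
    rw [QuadraticMap.polar, hQ', hQ', hQ', QuadraticMap.polar, map_add L]
    ring
  have h := isEquivalent_setIntegral_exp_neg_mul (μ := μ) (Q := Q') (e := e) (p := 1)
    (g := fun x => (√(2 * Real.pi))⁻¹ * millsRatio (-L x))
    (B := (√(2 * Real.pi))⁻¹ * (-L e)⁻¹) (C := (√(2 * Real.pi))⁻¹ * (-L e)⁻¹) hs hcone
    (fun a ha => (hQ' a).symm ▸ add_nonneg (hQ a ha) (by positivity))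
    (.const_mul (measurable_millsRatio.comp L.continuous_of_finiteDimensional.measurable.neg) _)
    (fun t ht a ha => ?_) (fun a _ => ?_) (by have := neg_pos.2 hL; positivity)
    (by simpa only [hpolar] using hint)
  · simp only [hpolar, hQ', neg_add, Real.exp_add, mul_assoc] at h ⊢
    simpa only [neg_mul, stdNormalCDF_eq_exp_mul_millsRatio] using h
  · rw [pow_one, mul_left_comm, abs_mul, abs_of_pos (by positivity)]
    gcongr
    exact abs_mul_millsRatio_neg_dual_le hL hLs ht ha
  · simpa only [pow_one, mul_left_comm] using
      (tendsto_mul_millsRatio_neg_dual hL a).const_mul (√(2 * Real.pi))⁻¹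

end RecedingCone

theorem integral_exp_neg_dotProduct_orthant {ι : Type*} [Fintype ι] {c : ι → ℝ}
    (hc : ∀ i, 0 < c i) :
    ∫ x in Set.univ.pi fun _ : ι => Set.Ioi 0, Real.exp (-(c ⬝ᵥ x)) = ∏ i, (c i)⁻¹ := by
  simp only [dotProduct, ← Finset.sum_neg_distrib, Real.exp_sum]
  rw [volume_pi, Measure.restrict_pi_pi,
    integral_fintype_prod_eq_prod fun i y => Real.exp (-(c i * y))]
  simp only [integral_Ioi_exp_neg_mul (hc _)]

section TailComparison

variable {M J : ℝ → ℝ} {c d K b p : ℝ} {k m : ℕ}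

theorem neg_log_isEquivalent (hc : 0 < c) (hK : 0 < K)
    (hM : M ~[atTop] fun t => c / t ^ k * Real.exp (-K * t ^ 2)) :
    (fun t => -Real.log (M t)) ~[atTop] fun t => K * t ^ 2 := by
  have hsq : Tendsto (fun t : ℝ => K * t ^ 2) atTop atTop :=
    (tendsto_pow_atTop two_ne_zero).const_mul_atTop hK
  have hlog : (fun t : ℝ => k * Real.log t) =o[atTop] fun t => K * t ^ 2 := by
    refine ((isLittleO_const_mul_right_iff hK.ne').2 ?_).const_mul_left (k : ℝ)
    simpa using isLittleO_log_rpow_atTop (show (0 : ℝ) < 2 by norm_num)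
  have hconst : (fun _ => Real.log c) =o[atTop] fun t : ℝ => K * t ^ 2 :=
    isLittleO_const_left.2 (Or.inr (tendsto_norm_atTop_atTop.comp hsq))
  have hpos : ∀ᶠ t : ℝ in atTop, 0 < c / t ^ k * Real.exp (-K * t ^ 2) := by
    filter_upwards [eventually_gt_atTop 0] with t ht
    positivity
  have hmodel : (fun t : ℝ => Real.log (c / t ^ k * Real.exp (-K * t ^ 2))⁻¹) ~[atTop]
      fun t => K * t ^ 2 := by
    refine (IsEquivalent.refl.add_isLittleO (hlog.sub hconst)).congr_left ?_
    filter_upwards [eventually_gt_atTop 0] with t ht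
    rw [Real.log_inv, Real.log_mul (by positivity) (by positivity),
      Real.log_div hc.ne' (by positivity), Real.log_pow, Real.log_exp]
    simp only [Pi.add_apply]
    ring
  have hinv : Tendsto (fun t : ℝ => (c / t ^ k * Real.exp (-K * t ^ 2))⁻¹) atTop atTop := by
    refine (Real.tendsto_exp_atTop.comp (hmodel.symm.tendsto_atTop hsq)).congr' ?_
    filter_upwards [hpos] with t ht
    exact Real.exp_log (inv_pos.2 ht)
  simpa only [Pi.inv_apply, Real.log_inv] using (hM.inv.log hinv).trans hmodel

theorem tail_div_eq_rpow_mul_rpow (hc : 0 < c) (hK : 0 < K) (hp : 2 * p = k * (1 + b) - m) {t : ℝ}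
    (ht : 0 < t) :
    d / t ^ m * Real.exp (-(K * (1 + b)) * t ^ 2) / (c / t ^ k * Real.exp (-K * t ^ 2))
      = d * c ^ (-(1 + b)) * K ^ (-p) * (c / t ^ k * Real.exp (-K * t ^ 2)) ^ b
        * (K * t ^ 2) ^ p := by
  have hcpow : c ^ (-(1 + b)) * c ^ b = c⁻¹ := by
    rw [← Real.rpow_add hc, ← Real.rpow_neg_one]
    ring_nf
  have hKpow : K ^ (-p) * K ^ p = 1 := by rw [← Real.rpow_add hK, neg_add_cancel, Real.rpow_zero]
  have htpow : (t ^ 2) ^ p / (t ^ k) ^ b = t ^ k / t ^ m := by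
    simp only [← Real.rpow_natCast, ← Real.rpow_mul ht.le, ← Real.rpow_sub ht]
    congr 1
    push_cast
    linear_combination hp
  have hexp : Real.exp (-(K * (1 + b)) * t ^ 2)
      = Real.exp (-K * t ^ 2) * Real.exp (-K * t ^ 2) ^ b := by
    rw [← Real.exp_mul, ← Real.exp_add]
    ring_nf
  rw [Real.mul_rpow (by positivity) (by positivity), Real.mul_rpow hK.le (by positivity),
    Real.div_rpow hc.le (by positivity), hexp]
  calc d / t ^ m * (Real.exp (-K * t ^ 2) * Real.exp (-K * t ^ 2) ^ b)
        / (c / t ^ k * Real.exp (-K * t ^ 2))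
      = d * c⁻¹ * (t ^ k / t ^ m) * Real.exp (-K * t ^ 2) ^ b := by field_simp
    _ = _ := by
      rw [← hcpow, ← htpow, ← mul_one (d * _), ← hKpow]
      ring

/-- The threshold `t` is eliminated through `t² ~ -log (M t) / K`. -/
theorem div_isEquivalent_rpow_mul_neg_log_rpow (hc : 0 < c) (hK : 0 < K)
    (hp : 2 * p = k * (1 + b) - m)
    (hM : M ~[atTop] fun t => c / t ^ k * Real.exp (-K * t ^ 2))
    (hJ : J ~[atTop] fun t => d / t ^ m * Real.exp (-(K * (1 + b)) * t ^ 2)) :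
    (fun t => J t / M t) ~[atTop] fun t =>
      d * c ^ (-(1 + b)) * K ^ (-p) * M t ^ b * (-Real.log (M t)) ^ p := by
  have hMabs : M ~[atTop] fun t => |c / t ^ k * Real.exp (-K * t ^ 2)| := by
    refine hM.congr_right ?_
    filter_upwards [eventually_gt_atTop 0] with t ht
    rw [abs_of_pos (by positivity)]
  have hpow := hMabs.rpow (r := b) fun t => abs_nonneg _
  have hlog := (neg_log_isEquivalent hc hK hM).rpow (r := p) fun t => mul_nonneg hK.le (sq_nonneg t)
  have hmodel := ((IsEquivalent.refl (u := fun _ : ℝ => d * c ^ (-(1 + b)) * K ^ (-p))).mul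
    hpow).mul hlog
  refine ((hJ.div hM).congr_right ?_).trans hmodel.symm
  filter_upwards [eventually_gt_atTop 0] with t ht
  simp only [Pi.div_apply, Pi.mul_apply, Pi.pow_apply]
  rw [tail_div_eq_rpow_mul_rpow hc hK hp ht, abs_of_pos (by positivity)]

end TailComparison

section Quantile

variable {ν : Measure ℝ} {u : ℝ}

theorem setOf_le_cdf_nonempty (hu : u < 1) : {x | u ≤ cdf ν x}.Nonempty :=
  ((tendsto_cdf_atTop ν).eventually_const_le hu).exists

theorem bddBelow_setOf_le_cdf (hu : 0 < u) : BddBelow {x | u ≤ cdf ν x} := by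
  obtain ⟨x, hx⟩ := ((tendsto_cdf_atBot ν).eventually_lt_const hu).exists
  exact ⟨x, fun y hy => ((monotone_cdf ν).reflect_lt (hx.trans_le hy)).le⟩

theorem tendsto_quantile (hν : ∀ x, cdf ν x < 1) : Tendsto (quantile ν) (𝓝[<] 1) atTop := by
  refine tendsto_atTop.2 fun x => ?_
  filter_upwards [Ioo_mem_nhdsLT (hν x)] with u hu
  exact le_csInf (setOf_le_cdf_nonempty hu.2) fun y hy =>
    ((monotone_cdf ν).reflect_lt (hu.1.trans_le hy)).le

variable [IsProbabilityMeasure ν]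

theorem continuous_cdf [NullSingletonClass ν] : Continuous (cdf ν) := by
  refine continuous_iff_continuousAt.2 fun x => ?_
  rw [(monotone_cdf ν).continuousAt_iff_leftLim_eq_rightLim, (cdf ν).rightLim_eq]
  have hjump := (cdf ν).measure_singleton x
  rw [measure_cdf, measure_singleton] at hjump
  exact le_antisymm ((monotone_cdf ν).leftLim_le le_rfl)
    (sub_nonpos.1 (ENNReal.ofReal_eq_zero.1 hjump.symm))

theorem cdf_quantile [NullSingletonClass ν] (hu₀ : 0 < u) (hu₁ : u < 1) :
    cdf ν (quantile ν u) = u := by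
  have hbdd := bddBelow_setOf_le_cdf (ν := ν) hu₀
  have hleft : Tendsto (cdf ν) (𝓝[<] quantile ν u) (𝓝 (cdf ν (quantile ν u))) :=
    continuous_cdf.continuousAt.mono_left nhdsWithin_le_nhds
  refine le_antisymm (le_of_tendsto hleft ?_)
    ((isClosed_le continuous_const continuous_cdf).csInf_mem (setOf_le_cdf_nonempty hu₁) hbdd)
  filter_upwards [self_mem_nhdsWithin] with x hx
  exact (not_le.1 (notMem_of_lt_csInf (s := {x | u ≤ cdf ν x}) hx hbdd)).le

theorem measureReal_Ioi_eq_one_sub_cdf (x : ℝ) : ν.real (Set.Ioi x) = 1 - cdf ν x := by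
  rw [cdf_eq_real, ← Set.compl_Iic, probReal_compl_eq_one_sub measurableSet_Iic]

theorem measureReal_Ioi_quantile [NullSingletonClass ν] (hu₀ : 0 < u) (hu₁ : u < 1) :
    ν.real (Set.Ioi (quantile ν u)) = 1 - u := by
  rw [measureReal_Ioi_eq_one_sub_cdf, cdf_quantile hu₀ hu₁]

theorem cdf_lt_one_of_isEquivalent {g : ℝ → ℝ} (hν : (fun t => ν.real (Set.Ioi t)) ~[atTop] g)
    (hg : ∀ᶠ t in atTop, 0 < g t) (x : ℝ) : cdf ν x < 1 := by
  obtain ⟨t, ht, hxt⟩ := ((hν.eventually_pos hg).and (eventually_ge_atTop x)).exists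
  rw [measureReal_Ioi_eq_one_sub_cdf, sub_pos] at ht
  exact (monotone_cdf ν hxt).trans_lt ht

end Quantile

section UpperTailDep

variable {Ω : Type*} [MeasurableSpace Ω] {P : Measure Ω}
  {X : Ω → Fin 2 → ℝ} {μ : Measure (Fin 2 → ℝ)} {ν : Measure ℝ}

theorem map_eval_absolutelyContinuous {ι : Type*} [Fintype ι] {μ : Measure (ι → ℝ)}
    (hμ : μ ≪ volume) (i : ι) : μ.map (· i) ≪ volume :=
  (hμ.map (measurable_pi_apply i)).trans
    (Measure.quasiMeasurePreserving_eval (fun _ : ι => volume) i).absolutelyContinuous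

theorem upperTailDep_eq_div (hX : HasLaw X μ P) (hμ : μ ≪ volume) (hν : ∀ i, μ.map (· i) = ν)
    (u : ℝ) :
    upperTailDep P X u
      = μ.real (Set.univ.pi fun _ => Set.Ioi (quantile ν u)) / ν.real (Set.Ioi (quantile ν u)) := by
  have hlaw : ∀ i, HasLaw (fun ω => X ω i) ν P := fun i =>
    HasLaw.comp ⟨(measurable_pi_apply i).aemeasurable, hν i⟩ hX
  have hνac : ν ≪ volume := hν 0 ▸ map_eval_absolutelyContinuous hμ 0
  rw [upperTailDep, (hlaw 0).map_eq, (hlaw 1).map_eq]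
  set q := quantile ν u
  have hnull : NullMeasurableSet {ω | q ≤ X ω 1} P :=
    (hlaw 1).aemeasurable.nullMeasurableSet_preimage measurableSet_Ici
  have hmarginal : P {ω | q ≤ X ω 1} = ν (Set.Ioi q) := by
    rw [measure_congr (hνac.ae_eq Ioi_ae_eq_Ici)]
    exact (hlaw 1).measure_eq measurableSet_Ici
  have hjoint : P ({ω | q ≤ X ω 0} ∩ {ω | q ≤ X ω 1}) = μ (Set.univ.pi fun _ => Set.Ioi q) := by
    have horthant : {ω | q ≤ X ω 0} ∩ {ω | q ≤ X ω 1} = X ⁻¹' Set.Ici fun _ => q := by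
      ext ω
      simp [Pi.le_def, Fin.forall_fin_two]
    rw [horthant, measure_congr (hμ.ae_eq Measure.univ_pi_Ioi_ae_eq_Ici)]
    exact hX.measure_eq measurableSet_Ici
  simp only [measureReal_def, ProbabilityTheory.cond, Measure.smul_apply,
    Measure.restrict_apply₀' hnull, hmarginal, hjoint, smul_eq_mul, ENNReal.toReal_mul,
    ENNReal.toReal_inv, div_eq_inv_mul]

theorem upperTailDep_isEquivalent [IsProbabilityMeasure P] {c d K b p : ℝ} {k m : ℕ}
    (hX : HasLaw X μ P) (hμ : μ ≪ volume) (hν : ∀ i, μ.map (· i) = ν) (hc : 0 < c) (hK : 0 < K)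
    (hp : 2 * p = k * (1 + b) - m)
    (hM : (fun t => ν.real (Set.Ioi t)) ~[atTop] fun t => c / t ^ k * Real.exp (-K * t ^ 2))
    (hJ : (fun t => μ.real (Set.univ.pi fun _ => Set.Ioi t)) ~[atTop]
      fun t => d / t ^ m * Real.exp (-(K * (1 + b)) * t ^ 2)) :
    upperTailDep P X ~[𝓝[<] 1] fun u =>
      d * c ^ (-(1 + b)) * K ^ (-p) * (1 - u) ^ b * (-Real.log (1 - u)) ^ p := by
  have : IsProbabilityMeasure μ := hX.isProbabilityMeasure_iff.1 ‹_›
  have : IsProbabilityMeasure ν :=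
    hν 0 ▸ Measure.isProbabilityMeasure_map (measurable_pi_apply 0).aemeasurable
  have hνac : ν ≪ volume := hν 0 ▸ map_eval_absolutelyContinuous hμ 0
  have : NullSingletonClass ν := ⟨fun x => hνac (measure_singleton x)⟩
  have hmodel : ∀ᶠ t : ℝ in atTop, 0 < c / t ^ k * Real.exp (-K * t ^ 2) := by
    filter_upwards [eventually_gt_atTop 0] with t ht
    positivity
  refine ((div_isEquivalent_rpow_mul_neg_log_rpow hc hK hp hM hJ).comp_tendsto
    (tendsto_quantile (cdf_lt_one_of_isEquivalent hM hmodel))).congr_left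
    (.of_forall fun u => (upperTailDep_eq_div hX hμ hν u).symm) |>.congr_right ?_
  filter_upwards [Ioo_mem_nhdsLT one_pos] with u hu
  simp only [Function.comp_apply, measureReal_Ioi_quantile hu.1 hu.2]

end UpperTailDep

theorem cdf_gaussianReal (m : ℝ) {v : NNReal} (hv : v ≠ 0) (x : ℝ) :
    cdf (gaussianReal m v) x = stdNormalCDF ((x - m) / √v) := by
  have hs : 0 < √(v : ℝ) := Real.sqrt_pos.2 (by positivity)
  have hstd : (gaussianReal 0 1).map (fun z => √(v : ℝ) * z + m) = gaussianReal m v := by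
    rw [← Function.comp_def (· + m) (√(v : ℝ) * ·), ← Measure.map_map (by fun_prop) (by fun_prop),
      gaussianReal_map_const_mul, gaussianReal_map_add_const]
    congr 1
    · simp
    · ext
      simp
  rw [stdNormalCDF, cdf_eq_real, cdf_eq_real, ← hstd,
    map_measureReal_apply (by fun_prop) measurableSet_Iic]
  congr 1
  ext z
  simp [le_div_iff₀ hs, le_sub_iff_add_le, mul_comm]

/-- For independent `Y ~ N(m, v)` and `Z ~ N(0, 1)`, both sides are the probability of
`Z - b Y ≤ a`. -/
theorem lintegral_stdNormalCDF_gaussianReal (a b m : ℝ) (v : NNReal) :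
    ∫⁻ y, ENNReal.ofReal (stdNormalCDF (a + b * y)) ∂gaussianReal m v
      = ENNReal.ofReal (stdNormalCDF ((a + b * m) / √(1 + b ^ 2 * v))) := by
  have hconv : ((gaussianReal m v).map (-b * ·)) ∗ gaussianReal 0 1
      = gaussianReal (-b * m + 0) (NNReal.mk ((-b) ^ 2) (sq_nonneg _) * v + 1) := by
    rw [gaussianReal_map_const_mul, gaussianReal_conv_gaussianReal]
  have hvar : ((NNReal.mk ((-b) ^ 2) (sq_nonneg _) * v + 1 : NNReal) : ℝ) = 1 + b ^ 2 * v := by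
    push_cast
    rw [neg_sq, add_comm]
  have hIic := congrArg (fun μ : Measure ℝ => μ (Set.Iic a)) hconv
  simp only [← ofReal_cdf] at hIic
  rw [cdf_gaussianReal _ (by positivity), hvar, Measure.conv,
    Measure.map_apply (by fun_prop) measurableSet_Iic,
    Measure.prod_apply (measurableSet_Iic.preimage (by fun_prop)),
    lintegral_map (measurable_measure_prodMk_left (measurableSet_Iic.preimage (by fun_prop)))
      (by fun_prop)] at hIic
  convert hIic using 3 with y
  · rw [stdNormalCDF, ofReal_cdf]
    congr 1
    ext z
    simp only [Set.mem_Iic, Set.mem_preimage]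
    constructor <;> intro h <;> linarith
  · rw [add_zero, neg_mul, sub_neg_eq_add]

theorem map_eval_withDensity {n : ℕ} {f : (Fin (n + 1) → ℝ) → ENNReal} (hf : Measurable f)
    (i : Fin (n + 1)) :
    (volume.withDensity f).map (· i)
      = volume.withDensity fun x => ∫⁻ y : Fin n → ℝ, f (i.insertNth x y) := by
  ext A hA
  have hA' : MeasurableSet ((fun x : Fin (n + 1) → ℝ => x i) ⁻¹' A) := measurable_pi_apply i hA
  have hsymm := (volume_preserving_piFinSuccAbove (fun _ => ℝ) i).symm
  rw [Measure.map_apply (measurable_pi_apply i) hA, withDensity_apply _ hA',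
    withDensity_apply _ hA, ← hsymm.setLIntegral_comp_preimage hA' hf]
  have hpre : (MeasurableEquiv.piFinSuccAbove (fun _ => ℝ) i).symm ⁻¹'
    ((fun x : Fin (n + 1) → ℝ => x i) ⁻¹' A) = A ×ˢ Set.univ := by
    ext
    simp
  rw [hpre, Measure.volume_eq_prod, setLIntegral_prod _
    (by exact (hf.comp (MeasurableEquiv.measurable _)).aemeasurable), Measure.restrict_univ]
  rfl

theorem det_corrMatrix (ρ : ℝ) : (corrMatrix ρ).det = 1 - ρ ^ 2 := by
  rw [corrMatrix, Matrix.det_fin_two_of]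
  ring

theorem dotProduct_inv_corrMatrix_mulVec (ρ : ℝ) (x : Fin 2 → ℝ) (i : Fin 2) :
    x ⬝ᵥ ((corrMatrix ρ)⁻¹ *ᵥ x)
      = (x i ^ 2 - 2 * ρ * x i * x (i.succAbove 0) + x (i.succAbove 0) ^ 2) / (1 - ρ ^ 2) := by
  rw [Matrix.inv_def, det_corrMatrix, Ring.inverse_eq_inv', corrMatrix, Matrix.adjugate_fin_two_of]
  fin_cases i <;> simp [Matrix.mulVec, dotProduct] <;> ring

section Marginal

variable {ρ : ℝ}

theorem bivNormalPDF_corrMatrix_eq_mul (hρ : 0 < 1 - ρ ^ 2) (x : Fin 2 → ℝ) (i : Fin 2) :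
    bivNormalPDF (corrMatrix ρ) x = gaussianPDFReal 0 1 (x i)
      * gaussianPDFReal (ρ * x i) (1 - ρ ^ 2).toNNReal (x (i.succAbove 0)) := by
  have hpi : √(2 * Real.pi) * √(2 * Real.pi) = 2 * Real.pi := Real.mul_self_sqrt (by positivity)
  rw [bivNormalPDF, det_corrMatrix, dotProduct_inv_corrMatrix_mulVec _ _ i,
    gaussianPDFReal_zero_one, gaussianPDFReal, Real.coe_toNNReal _ hρ.le,
    Real.sqrt_mul (by positivity) (1 - ρ ^ 2), mul_mul_mul_comm, ← Real.exp_add, ← mul_inv,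
    ← mul_assoc, hpi, one_div]
  congr 2
  field_simp
  ring

/-- The density `2 φ(x) Φ(l x)` of the univariate skew normal distribution. -/
def skewNormalPDFReal (l x : ℝ) : ℝ := 2 * gaussianPDFReal 0 1 x * stdNormalCDF (l * x)

/-- The univariate skew normal distribution with shape parameter `l`, the law of both marginals
of `SN₂`. -/
def skewNormalReal (l : ℝ) : Measure ℝ :=
  volume.withDensity fun x => ENNReal.ofReal (skewNormalPDFReal l x)

theorem measurable_skewNormalPDFReal (l : ℝ) : Measurable (skewNormalPDFReal l) :=
  ((measurable_gaussianPDFReal 0 1).const_mul 2).mul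
    (measurable_stdNormalCDF.comp (measurable_const_mul l))

theorem skewNormalPDFReal_nonneg (l x : ℝ) : 0 ≤ skewNormalPDFReal l x :=
  mul_nonneg (mul_nonneg two_pos.le (gaussianPDFReal_nonneg _ _ _)) (stdNormalCDF_pos _).le

theorem measurable_skewNormalPDF (θ : Fin 2 → ℝ) (R : Matrix (Fin 2) (Fin 2) ℝ) :
    Measurable (skewNormalPDF θ R) := by
  have hbiv : Measurable (bivNormalPDF R) := by
    unfold bivNormalPDF
    fun_prop
  exact (hbiv.const_mul 2).mul (measurable_stdNormalCDF.comp (by fun_prop))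

theorem skewNormalPDF_nonneg (θ : Fin 2 → ℝ) (R : Matrix (Fin 2) (Fin 2) ℝ) (x : Fin 2 → ℝ) :
    0 ≤ skewNormalPDF θ R x := by
  have := stdNormalCDF_pos (θ ⬝ᵥ x)
  unfold skewNormalPDF bivNormalPDF
  positivity

theorem skewNormalPDF_corrMatrix_eq_mul (hρ : 0 < 1 - ρ ^ 2) (θ x : Fin 2 → ℝ) (i : Fin 2) :
    skewNormalPDF θ (corrMatrix ρ) x = 2 * gaussianPDFReal 0 1 (x i)
      * (gaussianPDFReal (ρ * x i) (1 - ρ ^ 2).toNNReal (x (i.succAbove 0))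
        * stdNormalCDF (θ i * x i + θ (i.succAbove 0) * x (i.succAbove 0))) := by
  rw [skewNormalPDF, bivNormalPDF_corrMatrix_eq_mul hρ x i, dotProduct, Fin.sum_univ_succAbove _ i,
    Fin.sum_univ_one]
  ring

theorem lintegral_skewNormalPDF_insertNth (hρ : 0 < 1 - ρ ^ 2) (θ : Fin 2 → ℝ) (i : Fin 2)
    (x : ℝ) :
    ∫⁻ y : Fin 1 → ℝ, ENNReal.ofReal (skewNormalPDF θ (corrMatrix ρ) (i.insertNth x y))
      = ENNReal.ofReal (skewNormalPDFReal ((θ i + ρ * θ (i.succAbove 0))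
        / √(1 + θ (i.succAbove 0) ^ 2 * (1 - ρ ^ 2))) x) := by
  have hφ : 0 ≤ 2 * gaussianPDFReal 0 1 x := mul_nonneg two_pos.le (gaussianPDFReal_nonneg _ _ _)
  have hΦ : Measurable fun y =>
      ENNReal.ofReal (stdNormalCDF (θ i * x + θ (i.succAbove 0) * y)) :=
    (measurable_stdNormalCDF.comp (by fun_prop)).ennreal_ofReal
  have hconditional :
      ∫⁻ y : Fin 1 → ℝ, ENNReal.ofReal (gaussianPDFReal (ρ * x) (1 - ρ ^ 2).toNNReal (y 0))
          * ENNReal.ofReal (stdNormalCDF (θ i * x + θ (i.succAbove 0) * y 0))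
        = ∫⁻ y, ENNReal.ofReal (stdNormalCDF (θ i * x + θ (i.succAbove 0) * y))
          ∂gaussianReal (ρ * x) (1 - ρ ^ 2).toNNReal := by
    rw [gaussianReal_of_var_ne_zero _ (Real.toNNReal_pos.2 hρ).ne',
      lintegral_withDensity_eq_lintegral_mul _ (measurable_gaussianPDF _ _) hΦ]
    exact (volume_preserving_funUnique (Fin 1) ℝ).lintegral_comp
      ((measurable_gaussianPDF _ _).mul hΦ)
  simp only [skewNormalPDF_corrMatrix_eq_mul hρ θ _ i, Fin.insertNth_apply_same,
    Fin.insertNth_apply_succAbove, ENNReal.ofReal_mul hφ,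
    ENNReal.ofReal_mul (gaussianPDFReal_nonneg _ _ _)]
  rw [lintegral_const_mul' _ _ ENNReal.ofReal_ne_top, hconditional,
    lintegral_stdNormalCDF_gaussianReal, Real.coe_toNNReal _ hρ.le, ← ENNReal.ofReal_mul hφ,
    skewNormalPDFReal]
  ring_nf

theorem skewNormal_map_eval (hρ : 0 < 1 - ρ ^ 2) (θ : Fin 2 → ℝ) (i : Fin 2) :
    (skewNormal θ (corrMatrix ρ)).map (· i)
      = skewNormalReal ((θ i + ρ * θ (i.succAbove 0))
        / √(1 + θ (i.succAbove 0) ^ 2 * (1 - ρ ^ 2))) := by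
  rw [skewNormal, map_eval_withDensity (measurable_skewNormalPDF _ _).ennreal_ofReal]
  simp only [lintegral_skewNormalPDF_insertNth hρ, skewNormalReal]

end Marginal

section Tails

variable {ρ : ℝ} {θ : Fin 2 → ℝ}

theorem real_withDensity_ofReal {α : Type*} [MeasurableSpace α] {μ : Measure α} {f : α → ℝ}
    (hf : Measurable f) (hf₀ : ∀ x, 0 ≤ f x) {s : Set α} (hs : MeasurableSet s) :
    (μ.withDensity fun x => ENNReal.ofReal (f x)).real s = ∫ x in s, f x ∂μ := by
  rw [measureReal_def, withDensity_apply _ hs,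
    integral_eq_lintegral_of_nonneg_ae (.of_forall hf₀) hf.aestronglyMeasurable]

theorem skewNormalReal_real_Ioi (l t : ℝ) :
    (skewNormalReal l).real (Set.Ioi t) = 2 / √(2 * Real.pi)
      * ∫ x in {x | x - t • 1 ∈ Set.Ioi 0}, Real.exp (-halfSq x) * stdNormalCDF (l * x) := by
  rw [skewNormalReal, real_withDensity_ofReal (measurable_skewNormalPDFReal l)
    (skewNormalPDFReal_nonneg l) measurableSet_Ioi, setOf_sub_smul_one_mem_Ioi,
    ← integral_const_mul]
  simp only [skewNormalPDFReal, gaussianPDFReal_zero_one, halfSq_apply, neg_mul, mul_assoc,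
    div_eq_mul_inv]

theorem skewNormalReal_real_Ioi_isEquivalent_of_pos {l : ℝ} (hl : 0 < l) :
    (fun t => (skewNormalReal l).real (Set.Ioi t)) ~[atTop]
      fun t => 2 / √(2 * Real.pi) / t ^ 1 * Real.exp (-(1 / 2) * t ^ 2) := by
  have hint : ∫ a in Set.Ioi 0, Real.exp (-QuadraticMap.polar halfSq 1 a) = 1 := by
    simpa only [polar_halfSq, inv_one] using integral_Ioi_exp_neg_mul one_pos
  have h := isEquivalent_setIntegral_exp_neg_mul_stdNormalCDF_of_pos (μ := volume) (e := 1)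
    (L := l • LinearMap.id) measurableSet_Ioi (fun r hr a ha => mul_pos hr ha)
    (fun a _ => halfSq_nonneg a) (hl.trans_eq (mul_one l).symm) (hint.trans_ne one_ne_zero)
  refine ((IsEquivalent.refl (u := fun _ => 2 / √(2 * Real.pi))).mul h).congr_left
    (.of_forall fun t => (skewNormalReal_real_Ioi l t).symm) |>.congr_right (.of_forall fun t => ?_)
  simp only [Pi.mul_apply, hint, halfSq_apply, Module.finrank_self]
  ring_nf

theorem skewNormalReal_real_Ioi_isEquivalent_of_neg {l : ℝ} (hl : l < 0) :
    (fun t => (skewNormalReal l).real (Set.Ioi t)) ~[atTop]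
      fun t => (Real.pi * -l * (1 + l ^ 2))⁻¹ / t ^ 2 * Real.exp (-((1 + l ^ 2) / 2) * t ^ 2) := by
  have hint : ∫ a in Set.Ioi 0, Real.exp (-(QuadraticMap.polar halfSq 1 a
      + LinearMap.lsmul ℝ ℝ l 1 * LinearMap.lsmul ℝ ℝ l a)) = (1 + l ^ 2)⁻¹ := by
    rw [← integral_Ioi_exp_neg_mul (by positivity : 0 < 1 + l ^ 2)]
    congr! 4 with a
    rw [polar_halfSq, LinearMap.lsmul_apply, LinearMap.lsmul_apply, smul_eq_mul, smul_eq_mul]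
    ring
  have h := isEquivalent_setIntegral_exp_neg_mul_stdNormalCDF_of_neg (μ := volume) (e := 1)
    (L := LinearMap.lsmul ℝ ℝ l) measurableSet_Ioi (fun r hr a ha => mul_pos hr ha)
    (fun a _ => halfSq_nonneg a) ((mul_one l).trans_lt hl)
    (fun a ha => mul_nonpos_of_nonpos_of_nonneg hl.le (le_of_lt ha))
    (hint.trans_ne (by positivity))
  rw [hint] at h
  refine ((IsEquivalent.refl (u := fun _ => 2 / √(2 * Real.pi))).mul h).congr_left
    (.of_forall fun t => (skewNormalReal_real_Ioi l t).symm) |>.congr_right (.of_forall fun t => ?_)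
  have hpi : 2 / √(2 * Real.pi) * (√(2 * Real.pi))⁻¹ = Real.pi⁻¹ := by
    rw [← div_eq_mul_inv, div_div, Real.mul_self_sqrt (by positivity),
      div_mul_cancel_left₀ two_ne_zero]
  have hexp : -(1 / 2 * 1 ^ 2 + 1 / 2 * (l * 1) ^ 2) * t ^ 2 = -((1 + l ^ 2) / 2) * t ^ 2 := by ring
  simp only [Pi.mul_apply, halfSq_apply, Module.finrank_self, LinearMap.lsmul_apply,
    smul_eq_mul, hexp, mul_inv]
  linear_combination
    (-l)⁻¹ * (1 + l ^ 2)⁻¹ / t ^ 2 * Real.exp (-((1 + l ^ 2) / 2) * t ^ 2) * hpi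

/-- The quadratic form `x ↦ xᵀ R⁻¹ x / 2` in the exponent of the centered normal density with
covariance matrix `R`. -/
def normalForm (R : Matrix (Fin 2) (Fin 2) ℝ) : QuadraticForm ℝ (Fin 2 → ℝ) :=
  (1 / 2 : ℝ) • R⁻¹.toQuadraticForm'

theorem normalForm_apply (R : Matrix (Fin 2) (Fin 2) ℝ) (x : Fin 2 → ℝ) :
    normalForm R x = 1 / 2 * (x ⬝ᵥ R⁻¹ *ᵥ x) :=
  congrArg (1 / 2 * ·) (Matrix.toLinearMap₂'_apply' (T := ℝ) _ x x)

theorem normalForm_corrMatrix (ρ : ℝ) (x : Fin 2 → ℝ) :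
    normalForm (corrMatrix ρ) x
      = (x 0 ^ 2 - 2 * ρ * x 0 * x 1 + x 1 ^ 2) / (2 * (1 - ρ ^ 2)) := by
  rw [normalForm_apply, dotProduct_inv_corrMatrix_mulVec ρ x 0, Fin.zero_succAbove,
    Fin.succ_zero_eq_one, one_div_mul_eq_div, div_div, mul_comm (1 - ρ ^ 2)]

theorem normalForm_corrMatrix_nonneg (hρ : 0 < 1 - ρ ^ 2) (x : Fin 2 → ℝ) :
    0 ≤ normalForm (corrMatrix ρ) x := by
  rw [normalForm_corrMatrix]
  refine div_nonneg ?_ (by positivity)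
  nlinarith [sq_nonneg (x 0 - ρ * x 1), mul_nonneg hρ.le (sq_nonneg (x 1))]

theorem normalForm_corrMatrix_one (hρ : 1 - ρ ^ 2 ≠ 0) :
    normalForm (corrMatrix ρ) 1 = (1 + ρ)⁻¹ := by
  have hρ' : (1 - ρ) * (1 + ρ) ≠ 0 := by convert hρ using 1; ring
  have h₁ := left_ne_zero_of_mul hρ'
  have h₂ := right_ne_zero_of_mul hρ'
  rw [normalForm_corrMatrix, show 1 - ρ ^ 2 = (1 - ρ) * (1 + ρ) by ring, Pi.one_apply, Pi.one_apply]
  field_simp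
  ring

theorem polar_normalForm_corrMatrix_one (hρ : 1 - ρ ^ 2 ≠ 0) (x : Fin 2 → ℝ) :
    QuadraticMap.polar (normalForm (corrMatrix ρ)) 1 x = (1 + ρ)⁻¹ * ∑ i, x i := by
  have hρ' : (1 - ρ) * (1 + ρ) ≠ 0 := by convert hρ using 1; ring
  have h₁ := left_ne_zero_of_mul hρ'
  have h₂ := right_ne_zero_of_mul hρ'
  simp only [QuadraticMap.polar, normalForm_corrMatrix, Pi.add_apply, Pi.one_apply,
    Fin.sum_univ_two, show 1 - ρ ^ 2 = (1 - ρ) * (1 + ρ) by ring]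
  field_simp
  ring

theorem skewNormal_real_orthant (θ : Fin 2 → ℝ) (R : Matrix (Fin 2) (Fin 2) ℝ) (t : ℝ) :
    (skewNormal θ R).real (Set.univ.pi fun _ => Set.Ioi t) = 1 / (Real.pi * √R.det)
      * ∫ x in {x | x - t • 1 ∈ Set.univ.pi fun _ => Set.Ioi 0},
        Real.exp (-normalForm R x) * stdNormalCDF (θ ⬝ᵥ x) := by
  have horthant : {x : Fin 2 → ℝ | x - t • 1 ∈ Set.univ.pi fun _ => Set.Ioi 0}
      = Set.univ.pi fun _ => Set.Ioi t := by
    ext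
    simp
  rw [skewNormal, real_withDensity_ofReal (measurable_skewNormalPDF θ R)
    (skewNormalPDF_nonneg θ R) (.univ_pi fun _ => measurableSet_Ioi), horthant,
    ← integral_const_mul]
  congr! 2
  rw [skewNormalPDF, bivNormalPDF, normalForm_apply, neg_mul]
  ring

theorem skewNormal_corrMatrix_real_orthant_isEquivalent_of_pos (hρ : -1 < ρ) (hρ' : ρ < 1)
    (hθ : 0 < ∑ i, θ i) :
    (fun t => (skewNormal θ (corrMatrix ρ)).real (Set.univ.pi fun _ => Set.Ioi t)) ~[atTop]
      fun t => (1 + ρ) ^ 2 / (Real.pi * √(1 - ρ ^ 2)) / t ^ 2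
        * Real.exp (-(1 + ρ)⁻¹ * t ^ 2) := by
  have hρ₀ : 0 < 1 + ρ := by linarith
  have hdet : 0 < 1 - ρ ^ 2 := by nlinarith
  have hint : ∫ a in Set.univ.pi fun _ : Fin 2 => Set.Ioi 0,
      Real.exp (-QuadraticMap.polar (normalForm (corrMatrix ρ)) 1 a) = (1 + ρ) ^ 2 := by
    have h := integral_exp_neg_dotProduct_orthant fun _ : Fin 2 => inv_pos.2 hρ₀
    rw [Fin.prod_const, inv_inv] at h
    simpa only [polar_normalForm_corrMatrix_one hdet.ne', Finset.mul_sum, dotProduct] using h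
  have h := isEquivalent_setIntegral_exp_neg_mul_stdNormalCDF_of_pos (μ := volume) (e := 1)
    (L := dotProductBilin ℝ ℝ θ) (.univ_pi fun _ => measurableSet_Ioi)
    (fun r hr a ha i hi => mul_pos hr (ha i hi))
    (fun a _ => normalForm_corrMatrix_nonneg hdet a) (hθ.trans_eq (dotProduct_one θ).symm)
    (hint.trans_ne (by positivity))
  refine ((IsEquivalent.refl (u := fun _ => 1 / (Real.pi * √(1 - ρ ^ 2)))).mul h).congr_left
    (.of_forall fun t => ?_) |>.congr_right (.of_forall fun t => ?_)
  · rw [skewNormal_real_orthant, det_corrMatrix]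
    rfl
  · simp only [Pi.mul_apply, hint, normalForm_corrMatrix_one hdet.ne', Module.finrank_fin_fun]
    ring

theorem skewNormal_corrMatrix_real_orthant_isEquivalent_of_neg (hρ : -1 < ρ) (hρ' : ρ < 1)
    (hθ₀ : ∀ i, θ i ≤ 0) (hθ : ∑ i, θ i < 0) :
    (fun t => (skewNormal θ (corrMatrix ρ)).real (Set.univ.pi fun _ => Set.Ioi t)) ~[atTop]
      fun t => (√(2 * Real.pi))⁻¹ * (-∑ i, θ i)⁻¹ * (∏ i, ((1 + ρ)⁻¹ + (∑ j, θ j) * θ i)⁻¹)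
        / (Real.pi * √(1 - ρ ^ 2)) / t ^ 3
        * Real.exp (-((1 + ρ)⁻¹ + 1 / 2 * (∑ i, θ i) ^ 2) * t ^ 2) := by
  have hρ₀ : 0 < 1 + ρ := by linarith
  have hdet : 0 < 1 - ρ ^ 2 := by nlinarith
  have hrate (i : Fin 2) : 0 < (1 + ρ)⁻¹ + (∑ j, θ j) * θ i :=
    add_pos_of_pos_of_nonneg (by positivity) (mul_nonneg_of_nonpos_of_nonpos hθ.le (hθ₀ i))
  have hint : ∫ a in Set.univ.pi fun _ : Fin 2 => Set.Ioi 0,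
      Real.exp (-(QuadraticMap.polar (normalForm (corrMatrix ρ)) 1 a
        + dotProductBilin ℝ ℝ θ 1 * dotProductBilin ℝ ℝ θ a))
      = ∏ i, ((1 + ρ)⁻¹ + (∑ j, θ j) * θ i)⁻¹ := by
    rw [← integral_exp_neg_dotProduct_orthant hrate]
    congr! 4 with a
    rw [polar_normalForm_corrMatrix_one hdet.ne', dotProductBilin_apply_apply,
      dotProductBilin_apply_apply, dotProduct_one]
    simp only [dotProduct, Finset.mul_sum, add_mul, Finset.sum_add_distrib, mul_assoc]
  have hneg (a) (ha : a ∈ Set.univ.pi fun _ : Fin 2 => Set.Ioi 0) : θ ⬝ᵥ a ≤ 0 :=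
    Finset.sum_nonpos fun i _ => mul_nonpos_of_nonpos_of_nonneg (hθ₀ i) (le_of_lt (ha i trivial))
  have h := isEquivalent_setIntegral_exp_neg_mul_stdNormalCDF_of_neg (μ := volume) (e := 1)
    (L := dotProductBilin ℝ ℝ θ) (.univ_pi fun _ => measurableSet_Ioi)
    (fun r hr a ha i hi => mul_pos hr (ha i hi))
    (fun a _ => normalForm_corrMatrix_nonneg hdet a) ((dotProduct_one θ).trans_lt hθ)
    hneg
    (hint.trans_ne (Finset.prod_pos fun i _ => inv_pos.2 (hrate i)).ne')
  rw [hint] at h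
  refine ((IsEquivalent.refl (u := fun _ => 1 / (Real.pi * √(1 - ρ ^ 2)))).mul h).congr_left
    (.of_forall fun t => ?_) |>.congr_right (.of_forall fun t => ?_)
  · rw [skewNormal_real_orthant, det_corrMatrix]
    rfl
  · simp only [Pi.mul_apply, normalForm_corrMatrix_one hdet.ne', Module.finrank_fin_fun,
      dotProductBilin_apply_apply, dotProduct_one]
    ring

end Tails

section EqualSkewness

variable {ρ θ : ℝ}

/-- The paper's `λ`: for `θ < 0` both marginals of `SN₂((θ, θ), corrMatrix ρ)` are skew normal with
parameter `-λ`. -/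
def marginalSlope (ρ θ : ℝ) : ℝ := |θ| * (1 + ρ) / √(1 + θ ^ 2 * (1 - ρ ^ 2))

/-- The paper's `α`, which enters the constant of the upper tail dependence function only. -/
def tailCoeff (ρ θ : ℝ) : ℝ := |θ| * (1 + ρ) / √(1 + 2 * θ ^ 2 * (1 + ρ))

/-- The paper's `β`: for `θ < 0` the joint tail decays like the power `1 + β²` of the marginal
tails. -/
def tailExponent (ρ θ : ℝ) : ℝ := √((1 - ρ) * (1 + 2 * θ ^ 2 * (1 + ρ)) / (1 + ρ))

theorem sqrt_one_sub_sq (hρ : ρ ≤ 1) : √(1 - ρ ^ 2) = √(1 - ρ) * √(1 + ρ) := by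
  rw [← Real.sqrt_mul (sub_nonneg.2 hρ)]
  ring_nf

theorem one_add_sq_mul_one_sub_sq_pos (hρ : -1 < ρ) (hρ' : ρ < 1) (θ : ℝ) :
    0 < 1 + θ ^ 2 * (1 - ρ ^ 2) := by
  have : 0 < 1 - ρ ^ 2 := by nlinarith
  positivity

theorem one_add_marginalSlope_sq (hρ : -1 < ρ) (hρ' : ρ < 1) (θ : ℝ) :
    1 + marginalSlope ρ θ ^ 2 = (1 + 2 * θ ^ 2 * (1 + ρ)) / (1 + θ ^ 2 * (1 - ρ ^ 2)) := by
  have hB := one_add_sq_mul_one_sub_sq_pos hρ hρ' θ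
  rw [marginalSlope, div_pow, mul_pow, sq_abs, Real.sq_sqrt hB.le, eq_div_iff hB.ne', add_mul,
    div_mul_cancel₀ _ hB.ne']
  ring

theorem tailExponent_sq (hρ : -1 < ρ) (hρ' : ρ < 1) (θ : ℝ) :
    tailExponent ρ θ ^ 2 = (1 - ρ) * (1 + 2 * θ ^ 2 * (1 + ρ)) / (1 + ρ) := by
  have hρ₁ : 0 < 1 + ρ := by linarith
  have : 0 < 1 - ρ := by linarith
  exact Real.sq_sqrt (by positivity)

theorem one_add_tailExponent_sq (hρ : -1 < ρ) (hρ' : ρ < 1) (θ : ℝ) :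
    1 + tailExponent ρ θ ^ 2 = 2 * (1 + θ ^ 2 * (1 - ρ ^ 2)) / (1 + ρ) := by
  have hρ₁ : 0 < 1 + ρ := by linarith
  rw [tailExponent_sq hρ hρ']
  field_simp
  ring

theorem one_add_marginalSlope_sq_mul_one_add_tailExponent_sq (hρ : -1 < ρ) (hρ' : ρ < 1) (θ : ℝ) :
    (1 + marginalSlope ρ θ ^ 2) / 2 * (1 + tailExponent ρ θ ^ 2) = (1 + ρ)⁻¹ + 2 * θ ^ 2 := by
  have hρ₁ : 0 < 1 + ρ := by linarith
  have hB := one_add_sq_mul_one_sub_sq_pos hρ hρ' θ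
  rw [one_add_marginalSlope_sq hρ hρ', one_add_tailExponent_sq hρ hρ']
  field_simp

theorem orthant_const_of_neg (hρ : -1 < ρ) (hρ' : ρ < 1) (hθ : θ < 0) :
    (√(2 * Real.pi))⁻¹ * (-(2 * θ))⁻¹ * ((1 + ρ)⁻¹ + 2 * θ ^ 2)⁻¹ ^ 2 / (Real.pi * √(1 - ρ ^ 2))
      = tailCoeff ρ θ ^ 3 / (Real.pi * marginalSlope ρ θ ^ 4 * tailExponent ρ θ
        * (1 + tailExponent ρ θ ^ 2) ^ 2) * √(2 / Real.pi) := by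
  have hρ₁ : 0 < 1 + ρ := by linarith
  have hρ₂ : 0 < 1 - ρ := by linarith
  have hB := one_add_sq_mul_one_sub_sq_pos hρ hρ' θ
  have hA : 0 < 1 + 2 * θ ^ 2 * (1 + ρ) := by positivity
  have hrate : (1 + ρ)⁻¹ + 2 * θ ^ 2 = (1 + 2 * θ ^ 2 * (1 + ρ)) / (1 + ρ) := by field_simp
  rw [one_add_tailExponent_sq hρ hρ', hrate, tailExponent, tailCoeff, marginalSlope,
    sqrt_one_sub_sq hρ'.le, Real.sqrt_mul two_pos.le, Real.sqrt_div two_pos.le,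
    Real.sqrt_div (by positivity), Real.sqrt_mul hρ₂.le, abs_of_neg hθ, inv_div]
  have hpow {x : ℝ} (hx : 0 < x) : √x ^ 4 = x ^ 2 := by
    rw [pow_mul √x 2 2, Real.sq_sqrt hx.le]
  generalize 1 + 2 * θ ^ 2 * (1 + ρ) = A at hA
  generalize 1 + θ ^ 2 * (1 - ρ ^ 2) = B at hB
  field_simp
  rw [hpow hA, hpow hB, Real.sq_sqrt hρ₁.le, Real.sq_sqrt two_pos.le]
  ring

theorem rpow_const_of_neg {l : ℝ} (hl : 0 < l) (b : ℝ) :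
    (Real.pi * l * (1 + l ^ 2))⁻¹ ^ (-(1 + b)) * ((1 + l ^ 2) / 2) ^ (-(b - 1 / 2))
      = (2 * Real.pi * l) ^ (1 + b) * ((1 + l ^ 2) / 2) ^ (3 / 2 : ℝ) := by
  have hK : 0 < (1 + l ^ 2) / 2 := by positivity
  rw [Real.rpow_neg (by positivity), ← Real.inv_rpow (by positivity), inv_inv,
    show Real.pi * l * (1 + l ^ 2) = 2 * Real.pi * l * ((1 + l ^ 2) / 2) by ring,
    Real.mul_rpow (by positivity) hK.le, mul_assoc, ← Real.rpow_add hK]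
  ring_nf

theorem orthant_const_of_pos (hρ : -1 < ρ) (hρ' : ρ < 1) :
    (1 + ρ) ^ 2 / (Real.pi * √(1 - ρ ^ 2)) * (Real.pi / 2)
      = (1 + ρ) / 2 * √((1 + ρ) / (1 - ρ)) := by
  have hρ₁ : 0 < 1 + ρ := by linarith
  have := Real.sqrt_pos.2 (sub_pos.2 hρ')
  rw [sqrt_one_sub_sq hρ'.le, Real.sqrt_div hρ₁.le]
  field_simp
  exact (Real.sq_sqrt hρ₁.le).symm

theorem rpow_const_of_pos (p : ℝ) :
    (2 / √(2 * Real.pi)) ^ (-(2 * (1 + p))) * (1 / 2 : ℝ) ^ (-p)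
      = Real.pi / 2 * Real.pi ^ p := by
  have hsq : (2 / √(2 * Real.pi)) ^ (2 : ℝ) = (Real.pi / 2)⁻¹ := by
    rw [Real.rpow_two, div_pow, Real.sq_sqrt (by positivity)]
    field_simp
  rw [← mul_neg, Real.rpow_mul (by positivity), hsq, Real.rpow_neg_eq_inv_rpow, inv_inv,
    Real.rpow_neg_eq_inv_rpow, Real.rpow_add (by positivity), Real.rpow_one, mul_assoc,
    ← Real.mul_rpow (by positivity) (by positivity)]
  congr 2
  field_simp

theorem skewNormal_diag_map_eval (hρ : -1 < ρ) (hρ' : ρ < 1) (θ : ℝ) (i : Fin 2) :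
    (skewNormal ![θ, θ] (corrMatrix ρ)).map (· i)
      = skewNormalReal (θ * (1 + ρ) / √(1 + θ ^ 2 * (1 - ρ ^ 2))) := by
  have h (j : Fin 2) : ![θ, θ] j = θ := by fin_cases j <;> rfl
  rw [skewNormal_map_eval (by nlinarith), h, h, mul_one_add, mul_comm ρ]

variable {Ω : Type*} [MeasurableSpace Ω] {P : Measure Ω} [IsProbabilityMeasure P]
  {X : Ω → Fin 2 → ℝ}

theorem upperTailDep_isEquivalent_of_neg (hρ : -1 < ρ) (hρ' : ρ < 1) (hθ : θ < 0)
    (hX : HasLaw X (skewNormal ![θ, θ] (corrMatrix ρ)) P) :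
    upperTailDep P X ~[𝓝[<] 1] fun u =>
      tailCoeff ρ θ ^ 3 / (Real.pi * marginalSlope ρ θ ^ 4 * tailExponent ρ θ
          * (1 + tailExponent ρ θ ^ 2) ^ 2) * √(2 / Real.pi)
        * ((2 * Real.pi * marginalSlope ρ θ) ^ (1 + tailExponent ρ θ ^ 2)
          * ((1 + marginalSlope ρ θ ^ 2) / 2) ^ (3 / 2 : ℝ))
        * (1 - u) ^ (tailExponent ρ θ ^ 2)
        * (-Real.log (1 - u)) ^ (tailExponent ρ θ ^ 2 - 1 / 2) := by
  have hB := one_add_sq_mul_one_sub_sq_pos hρ hρ' θ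
  have hslope : 0 < marginalSlope ρ θ :=
    div_pos (mul_pos (abs_pos.2 hθ.ne) (by linarith)) (Real.sqrt_pos.2 hB)
  have hslope_neg : θ * (1 + ρ) / √(1 + θ ^ 2 * (1 - ρ ^ 2)) = -marginalSlope ρ θ := by
    rw [marginalSlope, abs_of_neg hθ, neg_mul, neg_div, neg_neg]
  have hmarginal (i : Fin 2) := skewNormal_diag_map_eval hρ hρ' θ i
  rw [hslope_neg] at hmarginal
  have hM := skewNormalReal_real_Ioi_isEquivalent_of_neg (neg_neg_of_pos hslope)
  rw [neg_neg, neg_sq] at hM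
  have hsum : ∑ i, ![θ, θ] i = 2 * θ := by simp [two_mul]
  have hJ := skewNormal_corrMatrix_real_orthant_isEquivalent_of_neg (θ := ![θ, θ]) hρ hρ'
    (by simp [Fin.forall_fin_two, hθ.le]) (by linarith)
  have hrate : (1 + ρ)⁻¹ + 1 / 2 * (2 * θ) ^ 2
      = (1 + marginalSlope ρ θ ^ 2) / 2 * (1 + tailExponent ρ θ ^ 2) := by
    rw [one_add_marginalSlope_sq_mul_one_add_tailExponent_sq hρ hρ']
    ring
  have hprod : ∏ i, ((1 + ρ)⁻¹ + 2 * θ * ![θ, θ] i)⁻¹ = ((1 + ρ)⁻¹ + 2 * θ ^ 2)⁻¹ ^ 2 := by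
    simp [Fin.prod_univ_two, mul_assoc, sq]
  rw [hsum, hprod, orthant_const_of_neg hρ hρ' hθ, hrate] at hJ
  have h := upperTailDep_isEquivalent (p := tailExponent ρ θ ^ 2 - 1 / 2) hX
    (withDensity_absolutelyContinuous _ _) hmarginal (by positivity) (by positivity)
    (by push_cast; ring) hM hJ
  refine h.congr_right (.of_forall fun u => ?_)
  rw [mul_assoc (_ * √_), rpow_const_of_neg hslope]

theorem upperTailDep_isEquivalent_of_pos (hρ : -1 < ρ) (hρ' : ρ < 1) (hθ : 0 < θ)
    (hX : HasLaw X (skewNormal ![θ, θ] (corrMatrix ρ)) P) :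
    upperTailDep P X ~[𝓝[<] 1] fun u =>
      (1 + ρ) / 2 * √((1 + ρ) / (1 - ρ)) * Real.pi ^ (-(ρ / (1 + ρ)))
        * (1 - u) ^ ((1 - ρ) / (1 + ρ)) * (-Real.log (1 - u)) ^ (-(ρ / (1 + ρ))) := by
  have hρ₁ : 0 < 1 + ρ := by linarith
  have hexponent : 1 + (1 - ρ) / (1 + ρ) = 2 * (1 + -(ρ / (1 + ρ))) := by
    field_simp
    ring
  have hrate : (1 + ρ)⁻¹ = 1 / 2 * (1 + (1 - ρ) / (1 + ρ)) := by
    field_simp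
    ring
  have hsum : 0 < ∑ i, ![θ, θ] i := by simp [hθ]
  have hM := skewNormalReal_real_Ioi_isEquivalent_of_pos
    (div_pos (mul_pos hθ hρ₁) (Real.sqrt_pos.2 (one_add_sq_mul_one_sub_sq_pos hρ hρ' θ)))
  have hJ := skewNormal_corrMatrix_real_orthant_isEquivalent_of_pos hρ hρ' hsum
  rw [hrate] at hJ
  have h := upperTailDep_isEquivalent (p := -(ρ / (1 + ρ))) hX
    (withDensity_absolutelyContinuous _ _) (skewNormal_diag_map_eval hρ hρ' θ) (by positivity)
    one_half_pos (by rw [hexponent]; push_cast; ring) hM hJ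
  refine h.congr_right (.of_forall fun u => ?_)
  rw [mul_assoc (_ / _), hexponent, rpow_const_of_pos, ← mul_assoc (_ / _),
    orthant_const_of_pos hρ hρ']

end EqualSkewness

end SkewNormal

end

theorem mainTheorem3 {Ω : Type*} [MeasurableSpace Ω] (P : Measure Ω) [IsProbabilityMeasure P]
    (ρ θ : ℝ) (hρ : -1 < ρ) (hρ' : ρ < 1)
    (X : Ω → Fin 2 → ℝ)
    (hX : HasLaw X (SkewNormal.skewNormal ![θ, θ] (SkewNormal.corrMatrix ρ)) P) :
    (θ < 0 → ∀ lam α β : ℝ,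
      lam = |θ| * (1 + ρ) / √(1 + θ ^ 2 * (1 - ρ ^ 2)) →
      α = |θ| * (1 + ρ) / √(1 + 2 * θ ^ 2 * (1 + ρ)) →
      β = √((1 - ρ) * (1 + 2 * θ ^ 2 * (1 + ρ)) / (1 + ρ)) →
      (fun u : ℝ => SkewNormal.upperTailDep P X u) ~[𝓝[<] (1 : ℝ)]
        fun u : ℝ =>
          (1 - u) ^ (β ^ 2) * (α ^ 3 / (Real.pi * lam ^ 4 * β * (1 + β ^ 2) ^ 2))
            * √(2 / Real.pi) * (2 * Real.pi * lam) ^ (1 + β ^ 2)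
            * ((1 + lam ^ 2) / 2) ^ (3 / 2 : ℝ)
            * (-Real.log (1 - u)) ^ (β ^ 2 - 1 / 2)) ∧
    (0 < θ →
      (fun u : ℝ => SkewNormal.upperTailDep P X u) ~[𝓝[<] (1 : ℝ)]
        fun u : ℝ =>
          (1 - u) ^ ((1 - ρ) / (1 + ρ)) * ((1 + ρ) / 2) * √((1 + ρ) / (1 - ρ))
            * (-Real.pi * Real.log (1 - u)) ^ (-(ρ / (1 + ρ)))) := by
  constructor
  · rintro hθ _ _ _ rfl rfl rfl
    refine (SkewNormal.upperTailDep_isEquivalent_of_neg hρ hρ' hθ hX).congr_right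
      (.of_forall fun u => ?_)
    simp only [SkewNormal.tailCoeff, SkewNormal.marginalSlope, SkewNormal.tailExponent]
    ring
  · intro hθ
    refine (SkewNormal.upperTailDep_isEquivalent_of_pos hρ hρ' hθ hX).congr_right ?_
    filter_upwards [Ioo_mem_nhdsLT one_pos] with u hu
    have hlog : 0 ≤ -Real.log (1 - u) :=
      neg_nonneg.2 (Real.log_nonpos (by linarith [hu.2]) (by linarith [hu.1]))
    rw [neg_mul_comm, Real.mul_rpow Real.pi_pos.le hlog]
    ring
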